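/- Let $\alpha,\beta$ be real numbers. There is a constant $C(\alpha,\beta)>0$, depending only on $\alpha$ and $\beta$, such that the following holds. Let $X=(X_1,\ldots,X_n)$ be a centered random vector in $\mathbb{R}^n$ (i.e. $\mathbb{E}X_i=0$ for all $i$) whose coordinates have finite second moments, such that $$\mathbb{P}(|X_i|\ge s,\ |X_j|\ge t)\le \alpha\,\mathbb{P}(|X_i|\ge s)\,\mathbb{P}(|X_j|\ge t)\qquad\text{for all } i\ne j \text{ and all } s,t>0,$$ and, with $\|Z\|_p=(\mathbb{E}|Z|^p)^{1/p}$, $$\|X_i\|_{2p}\le\beta\|X_i\|_p\qquad\text{for every } p\ge 2 \text{ and } i=1,\ldots,n.$$ Then for all $a\in\mathbb{R}^n$ and all real $p\ge 1$ the variable $\max_{i\le n}|a_iX_i|^p$ is integrable and $$\Bigl(\mathbb{E}\max_{i\le n}|a_iX_i|^p\Bigr)^{1/p}\le C(\alpha,\beta)\Bigl[\mathbb{E}\max_{i\le n}|a_iX_i|+\max_{i\le n}\bigl(\mathbb{E}|a_iX_i|^p\bigr)^{1/p}\Bigr].$$ -/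

import Mathlib

open MeasureTheory

/-! Put `Y i = |a i * X i|`, M = E max `Y i`, and t = K M with K depending only on α and β. By
Markov some `Y i` reaches t with probability at most 1/K. A second-moment count under the pairwise
hypothesis turns this bound on a union into Σ P(`Y i` ≥ t) ≤ 1 (`sum_measureReal_le_one`).

Doubling of moments makes tails collapse: P(Y ≥ 8β⁵t) ≤ P(Y ≥ t)² once t exceeds the L² scale
(`measureReal_tail_le_sq`). By Cauchy–Schwarz, the p-th moment of Y above u = 8β⁵t is then at most
(3β³)^p E Y^p P(Y ≥ t) (`setIntegral_rpow_tail_le`). The factor P(Y ≥ t) is linear, so summing over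
i costs nothing: E max `Y i`^p is at most u^p plus (3β³)^p max E `Y i`^p. -/

/-! ### Moments and tails of one nonnegative variable. -/

section OneVariable

variable {Ω : Type*} [MeasurableSpace Ω] {μ : Measure Ω}

/-- Cauchy–Schwarz for the integral of a function over a set. -/
lemma sq_setIntegral_le_integral_sq_mul_measureReal [IsFiniteMeasure μ] {Z : Ω → ℝ}
    (hZ : Integrable Z μ)
    (hZ2 : Integrable (fun ω => Z ω ^ 2) μ) {A : Set Ω} :
    (∫ ω in A, Z ω ∂μ) ^ 2 ≤ (∫ ω, Z ω ^ 2 ∂μ) * μ.real A := by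
  set a := ∫ ω in A, Z ω ∂μ with ha
  have h2 : ∫ ω in A, Z ω ^ 2 ∂μ ≤ ∫ ω, Z ω ^ 2 ∂μ :=
    setIntegral_le_integral hZ2 (Filter.Eventually.of_forall fun ω => sq_nonneg _)
  -- A quadratic in c that is nonnegative everywhere; its minimum, at c = a / P(A), gives the
  -- inequality.
  have key : ∀ c : ℝ, 0 ≤ ∫ ω in A, Z ω ^ 2 ∂μ - 2 * c * a + c ^ 2 * μ.real A := by
    intro c
    have h : ∫ ω in A, (Z ω - c) ^ 2 ∂μ
        = ∫ ω in A, Z ω ^ 2 ∂μ - 2 * c * a + c ^ 2 * μ.real A := by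
      have e : (fun ω => (Z ω - c) ^ 2) = fun ω => Z ω ^ 2 - 2 * c * Z ω + c ^ 2 := by
        ext ω; ring
      rw [e, integral_add, integral_sub, integral_const_mul]
      · simp [ha, mul_comm]
      · exact hZ2.restrict
      · exact (hZ.restrict).const_mul _
      · exact hZ2.restrict.sub ((hZ.restrict).const_mul _)
      · exact integrable_const _
    rw [← h]
    exact integral_nonneg fun ω => sq_nonneg _
  have hP : 0 ≤ μ.real A := measureReal_nonneg
  rcases hP.eq_or_lt with h0 | h0
  · have : a = 0 := by
      rw [ha]
      apply setIntegral_measure_zero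
      rw [← measureReal_eq_zero_iff]
      exact h0.symm
    rw [this, ← h0]; simp
  · have h := key (a / μ.real A)
    have e : 2 * (a / μ.real A) * a = 2 * (a ^ 2 / μ.real A) := by ring
    have e2 : (a / μ.real A) ^ 2 * μ.real A = a ^ 2 / μ.real A := by field_simp
    rw [e, e2] at h
    rw [← div_le_iff₀ h0]
    linarith

variable {Y : Ω → ℝ} {β : ℝ}

/-- Large values cannot carry the second moment, because the fourth is controlled by its square. So
the values below a multiple of the L² norm carry it, and there Y² is at most that multiple of Y. -/
lemma integral_sq_le_sq_integral (hβ : 1 ≤ β) (hY0 : ∀ ω, 0 ≤ Y ω)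
    (hint : ∀ q : ℝ, 1 ≤ q → Integrable (fun ω => Y ω ^ q) μ)
    (hmom : ∀ q : ℝ, 2 ≤ q → ∫ ω, Y ω ^ (2 * q) ∂μ ≤ β ^ (2 * q) * (∫ ω, Y ω ^ q ∂μ) ^ 2) :
    ∫ ω, Y ω ^ (2 : ℝ) ∂μ ≤ (3 * β ^ 2 * ∫ ω, Y ω ∂μ) ^ 2 := by
  have i1 : Integrable Y μ := by simpa using hint 1 le_rfl
  have h4 := hmom 2 le_rfl
  set m := ∫ ω, Y ω ^ (2 : ℝ) ∂μ with hm
  have hm0 : 0 ≤ m := integral_nonneg fun ω => Real.rpow_nonneg (hY0 ω) _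
  rcases hm0.eq_or_lt with h0 | h0
  · rw [← h0]; positivity
  obtain ⟨s, hs, hsm⟩ : ∃ s : ℝ, 0 < s ∧ m = s ^ 2 :=
    ⟨√m, Real.sqrt_pos.2 h0, (Real.sq_sqrt hm0).symm⟩
  -- Chosen so that E Y⁴ / l² ≤ β⁴s⁴ / l² = s²/4.
  set l := 2 * β ^ 2 * s with hl
  have hl0 : 0 < l := by positivity
  have pt : ∀ ω, Y ω ^ (2 : ℝ) ≤ l * Y ω + Y ω ^ (2 * 2 : ℝ) * (1 / l ^ 2) := by
    intro ω
    have e4 : Y ω ^ (2 * 2 : ℝ) = Y ω ^ 4 := by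
      rw [← Real.rpow_natCast]; norm_num
    have e2 : Y ω ^ (2 : ℝ) = Y ω ^ 2 := by
      rw [← Real.rpow_natCast]; norm_num
    rw [e4, e2]
    have := hY0 ω
    rcases le_total (Y ω) l with h | h
    · have : 0 ≤ Y ω ^ 4 * (1 / l ^ 2) := by positivity
      nlinarith
    · have h3 : Y ω ^ 2 * l ^ 2 ≤ Y ω ^ 4 := by
        have : l ^ 2 ≤ Y ω ^ 2 := by gcongr
        nlinarith [sq_nonneg (Y ω)]
      have : Y ω ^ 2 ≤ Y ω ^ 4 * (1 / l ^ 2) := by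
        rw [mul_one_div, le_div_iff₀ (by positivity)]; exact h3
      have : 0 ≤ l * Y ω := by positivity
      linarith
  have hI : m ≤ l * (∫ ω, Y ω ∂μ) + (∫ ω, Y ω ^ (2 * 2 : ℝ) ∂μ) * (1 / l ^ 2) := by
    rw [hm, ← integral_const_mul, ← integral_mul_const, ← integral_add]
    · exact integral_mono (hint 2 (by norm_num))
        ((i1.const_mul _).add ((hint _ (by norm_num)).mul_const _)) pt
    · exact i1.const_mul _
    · exact (hint _ (by norm_num)).mul_const _
  have hb : β ^ (2 * 2 : ℝ) = β ^ 4 := by rw [← Real.rpow_natCast]; norm_num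
  rw [hb] at h4
  have h5 : (∫ ω, Y ω ^ (2 * 2 : ℝ) ∂μ) * (1 / l ^ 2) ≤ s ^ 2 / 4 := by
    calc _ ≤ β ^ 4 * m ^ 2 * (1 / l ^ 2) := by gcongr
      _ = s ^ 2 / 4 := by
        rw [hl, hsm]; field_simp; norm_num
  rw [hsm] at hI ⊢
  have hm1 : 0 ≤ ∫ ω, Y ω ∂μ := integral_nonneg hY0
  have h6 : s ≤ 3 * β ^ 2 * ∫ ω, Y ω ∂μ := by
    have : s * (3 / 4 * s) ≤ s * (2 * β ^ 2 * ∫ ω, Y ω ∂μ) := by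
      rw [hl] at hI; linarith
    have := le_of_mul_le_mul_left this hs
    have : 0 ≤ β ^ 2 * ∫ ω, Y ω ∂μ := by positivity
    linarith
  gcongr

/-- Lyapunov's inequality. -/
lemma integral_rpow_le_of_one_le [IsProbabilityMeasure μ] (hY0 : ∀ ω, 0 ≤ Y ω)
    (hint : ∀ q : ℝ, 1 ≤ q → Integrable (fun ω => Y ω ^ q) μ) {r s : ℝ} (hr : 1 ≤ r)
    (hrs : r ≤ s) : (∫ ω, Y ω ^ r ∂μ) ^ (s / r) ≤ ∫ ω, Y ω ^ s ∂μ := by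
  have hr0 : 0 < r := by linarith
  have e : ∀ ω, (Y ω ^ r) ^ (s / r) = Y ω ^ s := fun ω => by
    rw [← Real.rpow_mul (hY0 ω)]; congr 1; field_simp
  have h1 : 1 ≤ s / r := by rw [le_div_iff₀ hr0]; linarith
  have := ConvexOn.map_integral_le (μ := μ) (f := fun ω => Y ω ^ r) (convexOn_rpow h1)
    (continuousOn_id.rpow_const fun x _ => Or.inr (by positivity)) isClosed_Ici
    (Filter.Eventually.of_forall fun ω => Real.rpow_nonneg (hY0 ω) _) (hint r hr)
    (by simpa only [Function.comp_def, e] using hint s (by linarith))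
  simpa only [e] using this

/-- Extends moment doubling from exponents at least 2 down to 1. For 1 ≤ p ≤ 2 the norms chain as
‖Y‖_{2p} ≤ ‖Y‖₄ ≤ β‖Y‖₂ ≤ 3β³‖Y‖₁ ≤ 3β³‖Y‖_p. -/
lemma integral_rpow_two_mul_le [IsProbabilityMeasure μ] (hβ : 1 ≤ β) (hY0 : ∀ ω, 0 ≤ Y ω)
    (hint : ∀ q : ℝ, 1 ≤ q → Integrable (fun ω => Y ω ^ q) μ)
    (hmom : ∀ q : ℝ, 2 ≤ q → ∫ ω, Y ω ^ (2 * q) ∂μ ≤ β ^ (2 * q) * (∫ ω, Y ω ^ q ∂μ) ^ 2)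
    {p : ℝ} (hp : 1 ≤ p) :
    ∫ ω, Y ω ^ (2 * p) ∂μ ≤ (3 * β ^ 3) ^ (2 * p) * (∫ ω, Y ω ^ p ∂μ) ^ 2 := by
  have hp0 : 0 < p := by linarith
  have hββ : β ≤ 3 * β ^ 3 := by nlinarith [one_le_pow₀ hβ (n := 2)]
  rcases le_total 2 p with h2 | h2
  · refine (hmom p h2).trans ?_
    gcongr
  have m1 : 0 ≤ ∫ ω, Y ω ∂μ := integral_nonneg hY0
  have m2 : 0 ≤ ∫ ω, Y ω ^ (2 : ℝ) ∂μ := integral_nonneg fun ω => Real.rpow_nonneg (hY0 ω) _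
  have mp : 0 ≤ ∫ ω, Y ω ^ (2 * p) ∂μ := integral_nonneg fun ω => Real.rpow_nonneg (hY0 ω) _
  have hA := integral_rpow_le_of_one_le hY0 hint (r := 2 * p) (s := 4) (by linarith)
    (by linarith)
  have hB : ∫ ω, Y ω ^ (4 : ℝ) ∂μ ≤ β ^ (4 : ℝ) * (∫ ω, Y ω ^ (2 : ℝ) ∂μ) ^ 2 := by
    have := hmom 2 le_rfl
    norm_num at this ⊢
    exact this
  have hC := integral_sq_le_sq_integral hβ hY0 hint hmom
  have hD := integral_rpow_le_of_one_le hY0 hint (r := 1) (s := p) le_rfl hp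
  simp only [Real.rpow_one, div_one] at hD
  calc ∫ ω, Y ω ^ (2 * p) ∂μ = ((∫ ω, Y ω ^ (2 * p) ∂μ) ^ (4 / (2 * p))) ^ (p / 2) := by
        rw [← Real.rpow_mul mp]
        have : 4 / (2 * p) * (p / 2) = 1 := by field_simp; norm_num
        rw [this, Real.rpow_one]
    _ ≤ (β ^ (4 : ℝ) * ((3 * β ^ 2 * ∫ ω, Y ω ∂μ) ^ 2) ^ 2) ^ (p / 2) := by
        refine Real.rpow_le_rpow (by positivity) ((hA.trans hB).trans ?_) (by positivity)
        gcongr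
    _ = ((3 * β ^ 3 * ∫ ω, Y ω ∂μ) ^ (4 : ℝ)) ^ (p / 2) := by
        congr 1
        rw [show (4 : ℝ) = ((4 : ℕ) : ℝ) by norm_num, Real.rpow_natCast, Real.rpow_natCast]
        ring
    _ = (3 * β ^ 3) ^ (2 * p) * ((∫ ω, Y ω ∂μ) ^ p) ^ 2 := by
        have e : (4 : ℝ) * (p / 2) = 2 * p := by ring
        have e' : p * ((2 : ℕ) : ℝ) = 2 * p := by push_cast; ring
        rw [← Real.rpow_mul (by positivity), e, Real.mul_rpow (by positivity) m1,
          ← Real.rpow_natCast (_ ^ p), ← Real.rpow_mul m1, e']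
    _ ≤ _ := by gcongr

lemma rpow_mul_measureReal_le_integral_rpow (hY0 : ∀ ω, 0 ≤ Y ω) {q : ℝ} (hq : 0 < q)
    (hint : Integrable (fun ω => Y ω ^ q) μ) {u : ℝ} (hu : 0 < u) :
    u ^ q * μ.real {ω | u ≤ Y ω} ≤ ∫ ω, Y ω ^ q ∂μ := by
  have h := mul_meas_ge_le_integral_of_nonneg
    (Filter.Eventually.of_forall fun ω => Real.rpow_nonneg (hY0 ω) q) hint (u ^ q)
  convert h using 4
  ext ω
  exact (Real.rpow_le_rpow_iff hu.le (hY0 ω) hq).symm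

/-- Beyond the scale of the second moment, the tail at a constant multiple of a level is at most
the square of the tail at that level. -/
lemma measureReal_tail_le_sq [IsProbabilityMeasure μ] (hβ : 1 ≤ β)
    (hYm : Measurable Y) (hY0 : ∀ ω, 0 ≤ Y ω)
    (hint : ∀ q : ℝ, 1 ≤ q → Integrable (fun ω => Y ω ^ q) μ)
    (hmom : ∀ q : ℝ, 2 ≤ q → ∫ ω, Y ω ^ (2 * q) ∂μ ≤ β ^ (2 * q) * (∫ ω, Y ω ^ q ∂μ) ^ 2)
    {t : ℝ} (ht : 0 < t) (h2 : ∫ ω, Y ω ^ (2 : ℝ) ∂μ < (2 * t) ^ 2) :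
    μ.real {ω | 8 * β ^ 5 * t ≤ Y ω} ≤ μ.real {ω | t ≤ Y ω} ^ 2 := by
  have hβ5 : 1 ≤ β ^ 5 := one_le_pow₀ hβ
  have hβ0 : 0 < β := by linarith
  have q1 : ∀ k : ℕ, 1 ≤ (2 : ℝ) ^ k := fun k => one_le_pow₀ (by norm_num)
  have q0 : ∀ k : ℕ, 0 < (2 : ℝ) ^ k := fun k => by positivity
  -- Look for the first dyadic exponent at which the norm of Y reaches 2t. If there is none, Markov
  -- at every dyadic exponent forces P(Y ≥ 3t) = 0.
  by_cases hex : ∃ k : ℕ, (2 * t) ^ ((2 : ℝ) ^ (k + 1)) ≤ ∫ ω, Y ω ^ ((2 : ℝ) ^ (k + 1)) ∂μ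
  swap
  · push Not at hex
    have h3 : μ.real {ω | 8 * β ^ 5 * t ≤ Y ω} ≤ μ.real {ω | 3 * t ≤ Y ω} := by
      refine measureReal_mono fun ω (h : 8 * β ^ 5 * t ≤ Y ω) => ?_
      have : 3 * t ≤ 8 * β ^ 5 * t := by nlinarith
      exact this.trans h
    refine (h3.trans ?_).trans (sq_nonneg _)
    have hk : ∀ k : ℕ, μ.real {ω | 3 * t ≤ Y ω} ≤ (2 / 3 : ℝ) ^ k := by
      intro k
      have ha := rpow_mul_measureReal_le_integral_rpow (μ := μ) hY0 (q0 (k + 1))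
        (hint _ (q1 (k + 1)))
        (u := 3 * t) (by positivity)
      have hb := ha.trans (hex k).le
      have hc : μ.real {ω | 3 * t ≤ Y ω} ≤ (2 / 3 : ℝ) ^ ((2 : ℝ) ^ (k + 1)) := by
        have e : (2 * t) ^ ((2 : ℝ) ^ (k + 1))
            = (3 * t) ^ ((2 : ℝ) ^ (k + 1)) * (2 / 3 : ℝ) ^ ((2 : ℝ) ^ (k + 1)) := by
          rw [← Real.mul_rpow (by positivity) (by positivity)]; congr 1; ring
        rw [e] at hb
        exact le_of_mul_le_mul_left hb (by positivity)
      refine hc.trans ?_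
      rw [← Real.rpow_natCast (2 / 3 : ℝ) k]
      refine Real.rpow_le_rpow_of_exponent_ge (by norm_num) (by norm_num) ?_
      have : (k + 1 : ℕ) < 2 ^ (k + 1) := Nat.lt_two_pow_self
      have : ((k + 1 : ℕ) : ℝ) < 2 ^ (k + 1) := by exact_mod_cast this
      push_cast at this
      linarith
    exact ge_of_tendsto' (tendsto_pow_atTop_nhds_zero_of_lt_one (by norm_num) (by norm_num)) hk
  · classical
    obtain ⟨k, hk, hmin⟩ : ∃ k : ℕ,
        (2 * t) ^ ((2 : ℝ) ^ (k + 1)) ≤ ∫ ω, Y ω ^ ((2 : ℝ) ^ (k + 1)) ∂μ ∧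
        ∀ j < k, ¬ (2 * t) ^ ((2 : ℝ) ^ (j + 1)) ≤ ∫ ω, Y ω ^ ((2 : ℝ) ^ (j + 1)) ∂μ :=
      ⟨Nat.find hex, Nat.find_spec hex, fun j hj => Nat.find_min hex hj⟩
    -- The exponent 2 is excluded by `h2`, so half of the first exponent is still at least 2 and
    -- moment doubling applies to it.
    rcases k with _ | k
    · exfalso
      norm_num at hk
      norm_num at h2
      linarith
    have hlt := not_le.1 (hmin k (Nat.lt_succ_self k))
    obtain ⟨r, hr⟩ : ∃ r : ℝ, r = (2 : ℝ) ^ (k + 1) := ⟨_, rfl⟩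
    have hr2 : 2 ≤ r := by
      rw [hr, pow_succ]; linarith [q1 k]
    have er : (2 : ℝ) ^ (k + 1 + 1) = 2 * r := by rw [hr, pow_succ]; ring
    rw [er] at hk
    rw [← hr] at hlt
    set m := ∫ ω, Y ω ^ (2 * r) ∂μ with hm
    have hrm : 0 ≤ ∫ ω, Y ω ^ r ∂μ := integral_nonneg fun ω => Real.rpow_nonneg (hY0 ω) _
    have hm0 : 0 < m := lt_of_lt_of_le (by positivity) hk
    have htr : t ^ (2 * r) ≤ m / 16 := by
      rw [Real.mul_rpow (by norm_num) ht.le] at hk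
      have : (16 : ℝ) ≤ 2 ^ (2 * r) := by
        calc (16 : ℝ) = 2 ^ (4 : ℝ) := by norm_num
          _ ≤ _ := Real.rpow_le_rpow_of_exponent_le (by norm_num) (by linarith)
      have : 0 < t ^ (2 * r) := by positivity
      nlinarith
    -- lower bound for the tail at `t`
    have hA : MeasurableSet {ω | t ≤ Y ω} := measurableSet_le measurable_const hYm
    have e4 : ∀ ω, (Y ω ^ (2 * r)) ^ 2 = Y ω ^ (2 * (2 * r)) := fun ω => by
      rw [← Real.rpow_natCast, ← Real.rpow_mul (hY0 ω)]; congr 1; push_cast; ring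
    have hcs := sq_setIntegral_le_integral_sq_mul_measureReal (μ := μ)
      (Z := fun ω => Y ω ^ (2 * r)) (A := {ω | t ≤ Y ω}) (hint _ (by linarith))
      (by simpa only [e4] using hint _ (by linarith))
    simp only [e4] at hcs
    have hcs2 := hcs.trans (mul_le_mul_of_nonneg_right (hmom (2 * r) (by linarith))
      measureReal_nonneg)
    rw [← hm] at hcs2
    have hcompl : ∫ ω in {ω | t ≤ Y ω}ᶜ, Y ω ^ (2 * r) ∂μ ≤ m / 16 := by
      calc _ ≤ ∫ ω in {ω | t ≤ Y ω}ᶜ, t ^ (2 * r) ∂μ := by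
            refine setIntegral_mono_on (hint _ (by linarith)).integrableOn
              (integrable_const _).integrableOn hA.compl fun ω hω => ?_
            have : Y ω < t := not_le.1 hω
            exact Real.rpow_le_rpow (hY0 ω) this.le (by linarith)
        _ = μ.real {ω | t ≤ Y ω}ᶜ * t ^ (2 * r) := by simp
        _ ≤ 1 * t ^ (2 * r) := by gcongr; exact measureReal_le_one
        _ ≤ _ := by linarith
    have hsum := integral_add_compl hA (hint (2 * r) (by linarith))
    rw [← hm] at hsum
    -- Paley–Zygmund: {Y ≥ t} carries at least 15/16 of m, and (15/16)² > 1/2.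
    have hlow : 1 / 2 ≤ β ^ (2 * (2 * r)) * μ.real {ω | t ≤ Y ω} := by
      have : (15 / 16 * m) ^ 2 ≤ (∫ ω in {ω | t ≤ Y ω}, Y ω ^ (2 * r) ∂μ) ^ 2 := by
        gcongr; linarith
      have h3 : m ^ 2 * (1 / 2) ≤ m ^ 2 * (β ^ (2 * (2 * r)) * μ.real {ω | t ≤ Y ω}) := by
        nlinarith [sq_nonneg m]
      exact le_of_mul_le_mul_left h3 (by positivity)
    -- upper bound for the tail at the larger level
    have hup : (8 * β ^ 5 * t) ^ (2 * r) * μ.real {ω | 8 * β ^ 5 * t ≤ Y ω}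
        ≤ (2 * β * t) ^ (2 * r) := by
      refine (rpow_mul_measureReal_le_integral_rpow hY0 (by linarith) (hint _ (by linarith))
        (by positivity)).trans ((hmom r hr2).trans ?_)
      have : (2 * β * t) ^ (2 * r) = β ^ (2 * r) * ((2 * t) ^ r) ^ 2 := by
        rw [← Real.rpow_natCast, ← Real.rpow_mul (by positivity),
          show r * ((2 : ℕ) : ℝ) = 2 * r by push_cast; ring,
          ← Real.mul_rpow (by positivity) (by positivity)]
        congr 1; ring
      rw [this]
      gcongr
    have e5 : (8 * β ^ 5 * t) ^ (2 * r)
        = (2 * β * t) ^ (2 * r) * ((4 : ℝ) ^ (2 * r) * (β ^ (2 * (2 * r))) ^ 2) := by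
      have : (β ^ (2 * (2 * r))) ^ 2 = (β ^ 4) ^ (2 * r) := by
        rw [← Real.rpow_natCast, ← Real.rpow_mul hβ0.le, ← Real.rpow_natCast β 4,
          ← Real.rpow_mul hβ0.le]
        congr 1; push_cast; ring
      rw [this, ← Real.mul_rpow (by positivity) (by positivity),
        ← Real.mul_rpow (by positivity) (by positivity)]
      congr 1; ring
    rw [e5] at hup
    have hup2 : (4 : ℝ) ^ (2 * r) * (β ^ (2 * (2 * r))) ^ 2
        * μ.real {ω | 8 * β ^ 5 * t ≤ Y ω} ≤ 1 := by
      refine le_of_mul_le_mul_left ?_ (show 0 < (2 * β * t) ^ (2 * r) by positivity)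
      linarith
    have h4 : (4 : ℝ) ≤ 4 ^ (2 * r) := by
      calc (4 : ℝ) = 4 ^ (1 : ℝ) := by norm_num
        _ ≤ _ := Real.rpow_le_rpow_of_exponent_le (by norm_num) (by linarith)
    set b := β ^ (2 * (2 * r)) with hb
    have hb0 : 0 < b := by positivity
    have h6 : 4 * (b ^ 2 * μ.real {ω | 8 * β ^ 5 * t ≤ Y ω}) ≤ 1 := by
      refine le_trans ?_ hup2
      rw [← mul_assoc]
      gcongr
    have h7 : (1 / 2) ^ 2 ≤ (b * μ.real {ω | t ≤ Y ω}) ^ 2 := by gcongr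
    have h8 : b ^ 2 * μ.real {ω | 8 * β ^ 5 * t ≤ Y ω} ≤ b ^ 2 * μ.real {ω | t ≤ Y ω} ^ 2 := by
      rw [mul_pow] at h7
      linarith
    exact le_of_mul_le_mul_left h8 (by positivity)

lemma setIntegral_rpow_tail_le [IsProbabilityMeasure μ] (hβ : 1 ≤ β)
    (hYm : Measurable Y) (hY0 : ∀ ω, 0 ≤ Y ω)
    (hint : ∀ q : ℝ, 1 ≤ q → Integrable (fun ω => Y ω ^ q) μ)
    (hmom : ∀ q : ℝ, 2 ≤ q → ∫ ω, Y ω ^ (2 * q) ∂μ ≤ β ^ (2 * q) * (∫ ω, Y ω ^ q ∂μ) ^ 2)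
    {t : ℝ} (ht : 0 < t) (h2 : ∫ ω, Y ω ^ (2 : ℝ) ∂μ < (2 * t) ^ 2) {p : ℝ} (hp : 1 ≤ p) :
    ∫ ω in {ω | 8 * β ^ 5 * t ≤ Y ω}, Y ω ^ p ∂μ
      ≤ (3 * β ^ 3) ^ p * (∫ ω, Y ω ^ p ∂μ) * μ.real {ω | t ≤ Y ω} := by
  have hβ0 : 0 < β := by linarith
  have e2 : ∀ x : ℝ, 0 ≤ x → (x ^ p) ^ 2 = x ^ (2 * p) := fun x hx => by
    rw [← Real.rpow_natCast, ← Real.rpow_mul hx]; congr 1; push_cast; ring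
  have e : ∀ ω, (Y ω ^ p) ^ 2 = Y ω ^ (2 * p) := fun ω => e2 _ (hY0 ω)
  have hcs := sq_setIntegral_le_integral_sq_mul_measureReal (μ := μ)
    (Z := fun ω => Y ω ^ p) (A := {ω | 8 * β ^ 5 * t ≤ Y ω}) (hint _ hp)
    (by simpa only [e] using hint _ (by linarith))
  simp only [e] at hcs
  have hm : 0 ≤ ∫ ω, Y ω ^ p ∂μ := integral_nonneg fun ω => Real.rpow_nonneg (hY0 ω) _
  refine le_of_pow_le_pow_left₀ two_ne_zero (by positivity) ?_
  refine hcs.trans ?_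
  rw [mul_pow, mul_pow, e2 _ (by positivity)]
  gcongr
  · exact integral_rpow_two_mul_le hβ hY0 hint hmom hp
  · exact measureReal_tail_le_sq hβ hYm hY0 hint hmom ht h2

end OneVariable

/-! ### Counting exceedances and bounding the maximum. -/

section Maximum

variable {Ω : Type*} [MeasurableSpace Ω] {μ : Measure Ω}

/-- If events are pairwise almost negatively correlated and their union is unlikely, then the
sum of their probabilities is at most one. -/
lemma sum_measureReal_le_one [IsProbabilityMeasure μ] {ι : Type*} [Fintype ι] {A : ι → Set Ω}
    (hA : ∀ i, MeasurableSet (A i)) {α K : ℝ} (hα : 0 ≤ α) (hK : α + 1 ≤ K)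
    (hpair : ∀ i j, i ≠ j → μ.real (A i ∩ A j) ≤ α * μ.real (A i) * μ.real (A j))
    (hU : K * μ.real (⋃ i, A i) ≤ 1) : ∑ i, μ.real (A i) ≤ 1 := by
  classical
  set S := ∑ i, μ.real (A i) with hS
  have hS0 : 0 ≤ S := Finset.sum_nonneg fun i _ => measureReal_nonneg
  have hUm : MeasurableSet (⋃ i, A i) := MeasurableSet.iUnion hA
  let N : Ω → ℝ := fun ω => ∑ i, (A i).indicator 1 ω
  have hi : ∀ B : Set Ω, MeasurableSet B → Integrable (B.indicator (1 : Ω → ℝ)) μ := fun B hB =>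
    (integrable_const (1 : ℝ)).indicator hB
  have hN1 : ∫ ω, N ω ∂μ = S := by
    simp only [N]
    rw [integral_finsetSum _ fun i _ => hi _ (hA i)]
    simp [integral_indicator_one, hA, hS]
  have hNi : Integrable N μ := integrable_finsetSum _ fun i _ => hi _ (hA i)
  have hNsq : ∀ ω, N ω ^ 2 = ∑ i, ∑ j, (A i ∩ A j).indicator (1 : Ω → ℝ) ω := fun ω => by
    simp only [N, sq, Finset.sum_mul_sum, Set.inter_indicator_one, Pi.mul_apply]
  have hNi2 : Integrable (fun ω => N ω ^ 2) μ := by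
    simp only [hNsq]
    exact integrable_finsetSum _ fun i _ => integrable_finsetSum _ fun j _ =>
      hi _ ((hA i).inter (hA j))
  have hN2 : ∫ ω, N ω ^ 2 ∂μ ≤ S + α * S ^ 2 := by
    have e : ∫ ω, N ω ^ 2 ∂μ = ∑ i, ∑ j, μ.real (A i ∩ A j) := by
      simp only [hNsq]
      rw [integral_finsetSum _ fun i _ => integrable_finsetSum _ fun j _ =>
        hi _ ((hA i).inter (hA j))]
      refine Finset.sum_congr rfl fun i _ => ?_
      rw [integral_finsetSum _ fun j _ => hi _ ((hA i).inter (hA j))]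
      exact Finset.sum_congr rfl fun j _ => integral_indicator_one ((hA i).inter (hA j))
    have e2 : S + α * S ^ 2
        = ∑ i, ∑ j, ((if i = j then μ.real (A i) else 0) + α * μ.real (A i) * μ.real (A j)) := by
      simp only [Finset.sum_add_distrib, Finset.sum_ite_eq, Finset.mem_univ, if_true]
      simp only [← Finset.mul_sum, ← Finset.sum_mul, ← hS]
      ring
    rw [e, e2]
    refine Finset.sum_le_sum fun i _ => Finset.sum_le_sum fun j _ => ?_
    split_ifs with h
    · subst h
      have : 0 ≤ α * μ.real (A i) * μ.real (A i) := by positivity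
      simpa using this
    · simpa using hpair i j h
  -- Since N vanishes off the union, this is AM–GM there. Integrated, it gives 2KS² ≤ S + αS² + KS²,
  -- hence S² ≤ S because K - α ≥ 1.
  have hpt : ∀ ω, 2 * (K * S) * N ω
      ≤ N ω ^ 2 + (K * S) ^ 2 * (⋃ i, A i).indicator (1 : Ω → ℝ) ω := by
    intro ω
    by_cases h : ω ∈ ⋃ i, A i
    · rw [Set.indicator_of_mem h, Pi.one_apply]
      nlinarith [sq_nonneg (N ω - K * S)]
    · have : N ω = 0 := Finset.sum_eq_zero fun i _ =>
        Set.indicator_of_notMem (fun hh => h (Set.mem_iUnion.2 ⟨i, hh⟩)) _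
      rw [Set.indicator_of_notMem h, this]
      simp
  have hI := integral_mono (hNi.const_mul (2 * (K * S)))
    (hNi2.add ((hi _ hUm).const_mul ((K * S) ^ 2))) hpt
  simp only [Pi.add_apply] at hI
  rw [integral_const_mul, integral_add hNi2 ((hi _ hUm).const_mul _), integral_const_mul, hN1,
    integral_indicator_one hUm] at hI
  have hK0 : 0 ≤ K := by linarith
  have h1 : (K * S) ^ 2 * μ.real (⋃ i, A i) ≤ K * S ^ 2 := by
    have := mul_le_mul_of_nonneg_left hU (show 0 ≤ K * S ^ 2 by positivity)
    linarith
  by_contra! hcon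
  nlinarith

variable {n : ℕ} {Y : Fin n → Ω → ℝ} {α β : ℝ}

lemma integrable_iSup (hY0 : ∀ i ω, 0 ≤ Y i ω) (hYi : ∀ i, Integrable (Y i) μ) :
    Integrable (fun ω => ⨆ i, Y i ω) μ := by
  refine Integrable.mono' (integrable_finsetSum Finset.univ fun i _ => hYi i)
    (AEMeasurable.iSup fun i => (hYi i).aemeasurable).aestronglyMeasurable
    (Filter.Eventually.of_forall fun ω => ?_)
  rw [Real.norm_of_nonneg (Real.iSup_nonneg fun i => hY0 i ω)]
  exact Real.iSup_le (fun i => Finset.single_le_sum (f := fun i => Y i ω)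
    (fun j _ => hY0 j ω) (Finset.mem_univ i)) (Finset.sum_nonneg fun j _ => hY0 j ω)

/-- In K, the summand α + 1 serves the counting of exceedances, and 3β² puts t above the L² scale of
each `Y i`. M is a free positive upper bound, so that t > 0 even when the maximum vanishes almost
surely. -/
lemma integral_iSup_rpow_le [IsProbabilityMeasure μ] (hα : 0 ≤ α) (hβ : 1 ≤ β)
    (hYm : ∀ i, Measurable (Y i))
    (hY0 : ∀ i ω, 0 ≤ Y i ω)
    (hint : ∀ i, ∀ q : ℝ, 1 ≤ q → Integrable (fun ω => Y i ω ^ q) μ)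
    (hmom : ∀ i, ∀ q : ℝ, 2 ≤ q →
      ∫ ω, Y i ω ^ (2 * q) ∂μ ≤ β ^ (2 * q) * (∫ ω, Y i ω ^ q ∂μ) ^ 2)
    (hpair : ∀ i j, i ≠ j → ∀ t : ℝ, 0 < t → μ.real {ω | t ≤ Y i ω ∧ t ≤ Y j ω} ≤
      α * μ.real {ω | t ≤ Y i ω} * μ.real {ω | t ≤ Y j ω})
    {p : ℝ} (hp : 1 ≤ p) {M W : ℝ} (hM : 0 < M) (hW : 0 ≤ W) (hYM : ∫ ω, ⨆ i, Y i ω ∂μ ≤ M)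
    (hYW : ∀ i, ∫ ω, Y i ω ^ p ∂μ ≤ W ^ p) :
    ∫ ω, ⨆ i, Y i ω ^ p ∂μ
      ≤ (8 * β ^ 5 * ((α + 1 + 3 * β ^ 2) * M) + 3 * β ^ 3 * W) ^ p := by
  have hβ0 : 0 < β := by linarith
  have hp0 : 0 < p := by linarith
  set K := α + 1 + 3 * β ^ 2 with hK
  have hK0 : 0 < K := by positivity
  set t := K * M with ht
  have ht0 : 0 < t := by positivity
  set u := 8 * β ^ 5 * t with hu
  have hu0 : 0 < u := by positivity
  have i1 : ∀ i, Integrable (Y i) μ := fun i => by simpa using hint i 1 le_rfl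
  have bdd : ∀ ω, BddAbove (Set.range fun i => Y i ω) := fun ω => (Set.finite_range _).bddAbove
  have hsupi := integrable_iSup hY0 i1
  -- the sum of the tails at level `t`
  have hS : ∑ i, μ.real {ω | t ≤ Y i ω} ≤ 1 := by
    refine sum_measureReal_le_one (K := K) (fun i => measurableSet_le measurable_const (hYm i))
      hα (by rw [hK]; linarith [sq_nonneg β]) (fun i j hij => hpair i j hij t ht0) ?_
    have h1 : μ.real (⋃ i, {ω | t ≤ Y i ω}) ≤ μ.real {ω | t ≤ ⨆ i, Y i ω} := by
      refine measureReal_mono fun ω hω => ?_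
      obtain ⟨i, hi⟩ := Set.mem_iUnion.1 hω
      exact le_trans hi (le_ciSup (bdd ω) i)
    have h2 := mul_meas_ge_le_integral_of_nonneg
      (Filter.Eventually.of_forall fun ω => Real.iSup_nonneg fun i => hY0 i ω) hsupi t
    have h3 : M * (K * μ.real (⋃ i, {ω | t ≤ Y i ω})) ≤ M * 1 := by
      calc _ = t * μ.real (⋃ i, {ω | t ≤ Y i ω}) := by rw [ht]; ring
        _ ≤ t * μ.real {ω | t ≤ ⨆ i, Y i ω} := by gcongr
        _ ≤ M * 1 := by linarith
    exact le_of_mul_le_mul_left h3 hM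
  -- the level `t` dominates the second moments
  have hsec : ∀ i, ∫ ω, Y i ω ^ (2 : ℝ) ∂μ < (2 * t) ^ 2 := by
    intro i
    refine (integral_sq_le_sq_integral hβ (hY0 i) (hint i) (hmom i)).trans_lt ?_
    have hm : ∫ ω, Y i ω ∂μ ≤ M :=
      (integral_mono (i1 i) hsupi fun ω => le_ciSup (bdd ω) i).trans hYM
    have hm0 : 0 ≤ ∫ ω, Y i ω ∂μ := integral_nonneg (hY0 i)
    have : 3 * β ^ 2 * ∫ ω, Y i ω ∂μ < 2 * t := by
      calc _ ≤ 3 * β ^ 2 * M := by gcongr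
        _ ≤ K * M := by gcongr; linarith
        _ < _ := by linarith
    gcongr
  have hmeas : ∀ i, MeasurableSet {ω | u ≤ Y i ω} := fun i =>
    measurableSet_le measurable_const (hYm i)
  have hind : ∀ i, Integrable ({ω | u ≤ Y i ω}.indicator fun ω => Y i ω ^ p) μ := fun i =>
    (hint i p hp).indicator (hmeas i)
  have hind0 : ∀ i ω, 0 ≤ {ω | u ≤ Y i ω}.indicator (fun ω => Y i ω ^ p) ω := fun i ω =>
    Set.indicator_nonneg (fun ω _ => Real.rpow_nonneg (hY0 i ω) p) ω
  have hpt : ∀ ω, ⨆ i, Y i ω ^ p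
      ≤ u ^ p + ∑ i, {ω | u ≤ Y i ω}.indicator (fun ω => Y i ω ^ p) ω := by
    intro ω
    have hs0 : 0 ≤ ∑ i, {ω | u ≤ Y i ω}.indicator (fun ω => Y i ω ^ p) ω :=
      Finset.sum_nonneg fun i _ => hind0 i ω
    refine Real.iSup_le (fun i => ?_) (by positivity)
    rcases le_or_gt u (Y i ω) with h | h
    · have h1 := Finset.single_le_sum
        (f := fun i => {ω | u ≤ Y i ω}.indicator (fun ω => Y i ω ^ p) ω)
        (fun j _ => hind0 j ω) (Finset.mem_univ i)
      have h2 : {ω | u ≤ Y i ω}.indicator (fun ω => Y i ω ^ p) ω = Y i ω ^ p :=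
        Set.indicator_of_mem (s := {ω | u ≤ Y i ω}) h _
      simp only [h2] at h1
      have : 0 ≤ u ^ p := by positivity
      linarith
    · have := Real.rpow_le_rpow (hY0 i ω) h.le hp0.le
      linarith
  calc ∫ ω, ⨆ i, Y i ω ^ p ∂μ
      ≤ ∫ ω, (u ^ p + ∑ i, {ω | u ≤ Y i ω}.indicator (fun ω => Y i ω ^ p) ω) ∂μ :=
        integral_mono (integrable_iSup (fun i ω => Real.rpow_nonneg (hY0 i ω) p)
          fun i => hint i p hp)
          ((integrable_const _).add (integrable_finsetSum _ fun i _ => hind i)) hpt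
    _ = u ^ p + ∑ i, ∫ ω in {ω | u ≤ Y i ω}, Y i ω ^ p ∂μ := by
        rw [integral_add (integrable_const _) (integrable_finsetSum _ fun i _ => hind i),
          integral_finsetSum _ fun i _ => hind i]
        simp only [integral_indicator (hmeas _)]
        simp
    _ ≤ u ^ p + ∑ i, (3 * β ^ 3) ^ p * W ^ p * μ.real {ω | t ≤ Y i ω} := by
        gcongr with i
        refine (setIntegral_rpow_tail_le hβ (hYm i) (hY0 i) (hint i) (hmom i) ht0 (hsec i)
          hp).trans ?_
        gcongr
        exact hYW i
    _ ≤ u ^ p + (3 * β ^ 3 * W) ^ p * 1 := by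
        rw [← Finset.mul_sum, Real.mul_rpow (by positivity) hW]
        gcongr
    _ ≤ _ := by
        rw [mul_one]
        exact Real.add_rpow_le_rpow_add hu0.le (by positivity) hp

end Maximum

/-! ### From `eLpNorm` hypotheses to real moments. -/

section Reduction

variable {Ω : Type*} [MeasurableSpace Ω] {μ : Measure Ω} [IsProbabilityMeasure μ]
  {X : Ω → ℝ} {β : ℝ}

/-- Finiteness propagates along 2, 4, 8, … by the doubling hypothesis, and lower exponents follow on
a probability space. -/
lemma memLp_of_eLpNorm_two_mul_le (hX : MemLp X 2 μ)
    (hreg : ∀ p : ℝ, 2 ≤ p → eLpNorm X (ENNReal.ofReal (2 * p)) μ ≤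
      ENNReal.ofReal β * eLpNorm X (ENNReal.ofReal p) μ) (q : ℝ) :
    MemLp X (ENNReal.ofReal q) μ := by
  have h : ∀ k : ℕ, MemLp X (ENNReal.ofReal ((2 : ℝ) ^ (k + 1))) μ := by
    intro k
    induction k with
    | zero => simpa using hX
    | succ k ih =>
      refine ⟨hX.1, ?_⟩
      have h2 : (2 : ℝ) ≤ 2 ^ (k + 1) := by
        rw [pow_succ]; linarith [one_le_pow₀ (one_le_two (α := ℝ)) (n := k)]
      have := hreg _ h2
      rw [pow_succ (2 : ℝ) (k + 1), mul_comm]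
      exact this.trans_lt (ENNReal.mul_lt_top ENNReal.ofReal_lt_top ih.2)
  obtain ⟨k, hk⟩ := pow_unbounded_of_one_lt q (one_lt_two (α := ℝ))
  refine (h k).mono_exponent (ENNReal.ofReal_le_ofReal (hk.le.trans ?_))
  exact pow_le_pow_right₀ one_le_two (Nat.le_succ k)

lemma integrable_abs_rpow_of_eLpNorm_two_mul_le (hX : MemLp X 2 μ)
    (hreg : ∀ p : ℝ, 2 ≤ p → eLpNorm X (ENNReal.ofReal (2 * p)) μ ≤
      ENNReal.ofReal β * eLpNorm X (ENNReal.ofReal p) μ) {q : ℝ} (hq : 0 ≤ q) :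
    Integrable (fun ω => |X ω| ^ q) μ := by
  have := (memLp_of_eLpNorm_two_mul_le hX hreg q).integrable_norm_rpow'
  simpa [ENNReal.toReal_ofReal hq] using this

lemma integral_abs_rpow_two_mul_le (hX : MemLp X 2 μ)
    (hreg : ∀ p : ℝ, 2 ≤ p → eLpNorm X (ENNReal.ofReal (2 * p)) μ ≤
      ENNReal.ofReal β * eLpNorm X (ENNReal.ofReal p) μ) {q : ℝ} (hq : 2 ≤ q) :
    ∫ ω, |X ω| ^ (2 * q) ∂μ ≤ max β 1 ^ (2 * q) * (∫ ω, |X ω| ^ q ∂μ) ^ 2 := by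
  have hq0 : 0 < q := by linarith
  have hb : 0 ≤ max β 1 := by positivity
  have m1 : 0 ≤ ∫ ω, |X ω| ^ q ∂μ := integral_nonneg fun ω => by positivity
  have m2 : 0 ≤ ∫ ω, |X ω| ^ (2 * q) ∂μ := integral_nonneg fun ω => by positivity
  have h : eLpNorm X (ENNReal.ofReal (2 * q)) μ ≤
      ENNReal.ofReal (max β 1) * eLpNorm X (ENNReal.ofReal q) μ := by
    refine (hreg q hq).trans ?_
    gcongr
    exact le_max_left _ _
  rw [(memLp_of_eLpNorm_two_mul_le hX hreg q).eLpNorm_eq_integral_rpow_norm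
      (by simpa using hq0) ENNReal.ofReal_ne_top,
    (memLp_of_eLpNorm_two_mul_le hX hreg (2 * q)).eLpNorm_eq_integral_rpow_norm
      (by simpa using hq0) ENNReal.ofReal_ne_top,
    ENNReal.toReal_ofReal hq0.le, ENNReal.toReal_ofReal (by positivity),
    ← ENNReal.ofReal_mul hb, ENNReal.ofReal_le_ofReal_iff (by positivity)] at h
  simp only [Real.norm_eq_abs] at h
  have h2 := Real.rpow_le_rpow (by positivity) h (show 0 ≤ 2 * q by positivity)
  rw [Real.rpow_inv_rpow m2 (by positivity), Real.mul_rpow hb (by positivity),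
    ← Real.rpow_mul m1] at h2
  have e : q⁻¹ * (2 * q) = (2 : ℕ) := by push_cast; field_simp
  rwa [e, Real.rpow_natCast] at h2

end Reduction

/-! ### The theorem for weighted coordinates. -/

theorem mainTheorem7 (α β : ℝ) :
    ∃ C : ℝ, 0 < C ∧
      ∀ (n : ℕ) (Ω : Type*) [MeasurableSpace Ω] (μ : Measure Ω) [IsProbabilityMeasure μ]
        (X : Fin n → Ω → ℝ),
        (∀ i, MemLp (X i) 2 μ) →
        (∀ i, ∫ ω, X i ω ∂μ = 0) →
        (∀ i j, i ≠ j → ∀ s t : ℝ, 0 < s → 0 < t →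
          μ.real {ω | s ≤ |X i ω| ∧ t ≤ |X j ω|} ≤
            α * μ.real {ω | s ≤ |X i ω|} * μ.real {ω | t ≤ |X j ω|}) →
        (∀ p : ℝ, 2 ≤ p → ∀ i,
          eLpNorm (X i) (ENNReal.ofReal (2 * p)) μ ≤
            ENNReal.ofReal β * eLpNorm (X i) (ENNReal.ofReal p) μ) →
        ∀ (a : Fin n → ℝ) (p : ℝ), 1 ≤ p →
          Integrable (fun ω => ⨆ i, |a i * X i ω| ^ p) μ ∧
          (∫ ω, ⨆ i, |a i * X i ω| ^ p ∂μ) ^ (1 / p) ≤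
            C * ((∫ ω, ⨆ i, |a i * X i ω| ∂μ) +
              ⨆ i, (∫ ω, |a i * X i ω| ^ p ∂μ) ^ (1 / p)) := by
  -- Enlarging the constants preserves both hypotheses and secures the signs and the bound β ≥ 1
  -- used above.
  set α' := max α 0 with hα'
  set β' := max β 1 with hβ'
  have hα0 : 0 ≤ α' := le_max_right _ _
  have hβ1 : 1 ≤ β' := le_max_right _ _
  have hβ0 : 0 < β' := by linarith
  refine ⟨8 * β' ^ 5 * (α' + 1 + 3 * β' ^ 2) + 3 * β' ^ 3, by positivity, ?_⟩
  intro n Ω _ μ _ X hX2 _ hpair hreg a p hp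
  have hp0 : 0 < p := by linarith
  -- measurable representatives
  let Z : Fin n → Ω → ℝ := fun i => (hX2 i).1.mk (X i)
  have hZX : ∀ i, X i =ᵐ[μ] Z i := fun i => (hX2 i).1.ae_eq_mk
  have hZm : ∀ i, Measurable (Z i) := fun i => (hX2 i).1.stronglyMeasurable_mk.measurable
  let Y : Fin n → Ω → ℝ := fun i ω => |a i * Z i ω|
  have hall : ∀ᵐ ω ∂μ, ∀ i, |a i * X i ω| = Y i ω := by
    rw [ae_all_iff]
    intro i
    filter_upwards [hZX i] with ω h
    simp only [Y, h]
  have hY0 : ∀ i ω, 0 ≤ Y i ω := fun i ω => abs_nonneg _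
  have hYm : ∀ i, Measurable (Y i) := fun i => ((hZm i).const_mul (a i)).abs
  have hYr : ∀ i, ∀ q : ℝ, (fun ω => Y i ω ^ q) =ᵐ[μ] fun ω => |a i| ^ q * |X i ω| ^ q := by
    intro i q
    filter_upwards [hZX i] with ω h
    simp only [Y]
    rw [abs_mul, h, Real.mul_rpow (abs_nonneg _) (abs_nonneg _)]
  have hint : ∀ i, ∀ q : ℝ, 1 ≤ q → Integrable (fun ω => Y i ω ^ q) μ := by
    intro i q hq
    exact ((integrable_abs_rpow_of_eLpNorm_two_mul_le (hX2 i) (fun p hp => hreg p hp i)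
      (by linarith)).const_mul _).congr (hYr i q).symm
  have hmom : ∀ i, ∀ q : ℝ, 2 ≤ q →
      ∫ ω, Y i ω ^ (2 * q) ∂μ ≤ β' ^ (2 * q) * (∫ ω, Y i ω ^ q ∂μ) ^ 2 := by
    intro i q hq
    rw [integral_congr_ae (hYr i (2 * q)), integral_congr_ae (hYr i q), integral_const_mul,
      integral_const_mul]
    have h := integral_abs_rpow_two_mul_le (hX2 i) (fun p hp => hreg p hp i) hq
    have e : |a i| ^ (2 * q) = (|a i| ^ q) ^ 2 := by
      rw [← Real.rpow_natCast, ← Real.rpow_mul (abs_nonneg _)]; congr 1; push_cast; ring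
    calc _ ≤ |a i| ^ (2 * q) * (β' ^ (2 * q) * (∫ ω, |X i ω| ^ q ∂μ) ^ 2) := by gcongr
      _ = _ := by rw [e]; ring
  have hpairY : ∀ i j, i ≠ j → ∀ t : ℝ, 0 < t → μ.real {ω | t ≤ Y i ω ∧ t ≤ Y j ω} ≤
      α' * μ.real {ω | t ≤ Y i ω} * μ.real {ω | t ≤ Y j ω} := by
    intro i j hij t ht
    -- A zero weight makes the event empty, since t > 0; otherwise dividing by the weights yields
    -- two different levels, which is why the hypothesis is needed for separate s and t.
    by_cases hi : a i = 0
    · have : {ω | t ≤ Y i ω ∧ t ≤ Y j ω} = ∅ := by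
        ext ω
        simp [Y, hi, ht]
      rw [this, measureReal_empty]
      positivity
    by_cases hj : a j = 0
    · have : {ω | t ≤ Y i ω ∧ t ≤ Y j ω} = ∅ := by
        ext ω
        simp [Y, hj, ht]
      rw [this, measureReal_empty]
      positivity
    have hlev : ∀ k, a k ≠ 0 → ∀ᵐ ω ∂μ, t ≤ Y k ω ↔ t / |a k| ≤ |X k ω| := by
      intro k hk
      filter_upwards [hZX k] with ω h
      simp only [Y]
      rw [abs_mul, ← h, div_le_iff₀ (abs_pos.2 hk), mul_comm]
    have e1 : μ.real {ω | t ≤ Y i ω} = μ.real {ω | t / |a i| ≤ |X i ω|} :=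
      measureReal_congr (by filter_upwards [hlev i hi] with ω h using propext h)
    have e2 : μ.real {ω | t ≤ Y j ω} = μ.real {ω | t / |a j| ≤ |X j ω|} :=
      measureReal_congr (by filter_upwards [hlev j hj] with ω h using propext h)
    have e3 : μ.real {ω | t ≤ Y i ω ∧ t ≤ Y j ω}
        = μ.real {ω | t / |a i| ≤ |X i ω| ∧ t / |a j| ≤ |X j ω|} :=
      measureReal_congr (by
        filter_upwards [hlev i hi, hlev j hj] with ω h h' using propext (and_congr h h'))
    rw [e1, e2, e3]
    refine (hpair i j hij _ _ (div_pos ht (abs_pos.2 hi)) (div_pos ht (abs_pos.2 hj))).trans ?_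
    gcongr
    exact le_max_left _ _
  have hsupp : (fun ω => ⨆ i, |a i * X i ω| ^ p) =ᵐ[μ] fun ω => ⨆ i, Y i ω ^ p := by
    filter_upwards [hall] with ω h
    simp only [h]
  have hsup1 : (fun ω => ⨆ i, |a i * X i ω|) =ᵐ[μ] fun ω => ⨆ i, Y i ω := by
    filter_upwards [hall] with ω h
    simp only [h]
  have hmomp : ∀ i, ∫ ω, |a i * X i ω| ^ p ∂μ = ∫ ω, Y i ω ^ p ∂μ := fun i =>
    integral_congr_ae (by filter_upwards [hall] with ω h using by simp only [h])
  refine ⟨(integrable_iSup (fun i ω => Real.rpow_nonneg (hY0 i ω) p)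
    fun i => hint i p hp).congr hsupp.symm, ?_⟩
  simp only [hmomp]
  rw [integral_congr_ae hsupp, integral_congr_ae hsup1]
  set M := ∫ ω, ⨆ i, Y i ω ∂μ with hM
  set W := ⨆ i, (∫ ω, Y i ω ^ p ∂μ) ^ (1 / p) with hW
  have mp : ∀ i, 0 ≤ ∫ ω, Y i ω ^ p ∂μ := fun i =>
    integral_nonneg fun ω => Real.rpow_nonneg (hY0 i ω) p
  have hM0 : 0 ≤ M := integral_nonneg fun ω => Real.iSup_nonneg fun i => hY0 i ω
  have hW0 : 0 ≤ W := Real.iSup_nonneg fun i => Real.rpow_nonneg (mp i) _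
  have hYW : ∀ i, ∫ ω, Y i ω ^ p ∂μ ≤ W ^ p := by
    intro i
    have h1 : (∫ ω, Y i ω ^ p ∂μ) ^ (1 / p) ≤ W :=
      le_ciSup (f := fun i => (∫ ω, Y i ω ^ p ∂μ) ^ (1 / p)) (Set.finite_range _).bddAbove i
    have h2 := Real.rpow_le_rpow (Real.rpow_nonneg (mp i) _) h1 hp0.le
    rwa [one_div, Real.rpow_inv_rpow (mp i) hp0.ne'] at h2
  set D := 8 * β' ^ 5 * (α' + 1 + 3 * β' ^ 2) with hD
  have hD0 : 0 < D := by positivity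
  -- M may be 0, so the bound is applied to M + ε/D, which costs exactly ε.
  have hε : ∀ ε > 0, (∫ ω, ⨆ i, Y i ω ^ p ∂μ) ^ (1 / p)
      ≤ (D + 3 * β' ^ 3) * (M + W) + ε := by
    intro ε hε
    have hη : 0 < ε / D := by positivity
    have h := integral_iSup_rpow_le hα0 hβ1 hYm hY0 hint hmom hpairY hp
      (M := M + ε / D) (W := W) (by positivity) hW0 (by linarith) hYW
    have h2 := Real.rpow_le_rpow
      (integral_nonneg fun ω => Real.iSup_nonneg fun i => Real.rpow_nonneg (hY0 i ω) p) h
      (show 0 ≤ 1 / p by positivity)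
    rw [one_div, Real.rpow_rpow_inv (by positivity) hp0.ne', ← one_div] at h2
    refine h2.trans ?_
    have e : 8 * β' ^ 5 * ((α' + 1 + 3 * β' ^ 2) * (M + ε / D)) = D * M + ε := by
      rw [← mul_assoc, ← hD]; field_simp
    rw [e]
    have : 0 ≤ D * W := by positivity
    have : 0 ≤ 3 * β' ^ 3 * M := by positivity
    linarith
  exact le_of_forall_pos_le_add hε
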